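/- Let $H$ be a complex Hilbert space (inner product linear in the first entry), $\mathcal B(H)$ the algebra of bounded operators on $H$ and $\mathcal K\subseteq\mathcal B(H)$ the compact operators. Let $V\subseteq\{\xi\in H:\|\xi\|=1\}$ be a norm-closed set of unit vectors such that (V1) $\lambda V\subseteq V$ for every $\lambda\in\mathbb C$ with $|\lambda|=1$; (V2) if $\xi\in H$ satisfies $\langle\xi,\eta\rangle=0$ for all $\eta\in V$, then $\xi=0$. For $X\in\mathcal B(H)$ put $\|X\|_V=\sup_{\xi,\eta\in V}|\langle X\xi,\eta\rangle|$, and for a normal functional $\rho$ on $\mathcal B(H)$, that is, one of the form $\rho(A)=\sum_{n}\langle A\xi_n,\eta_n\rangle$ with $\sum_n\|\xi_n\|^2<\infty$ and $\sum_n\|\eta_n\|^2<\infty$, put $$E(\rho)=\sup\{|\rho(X)|: X=K+\lambda\mathbf 1,\ K\in\mathcal K,\ \lambda\in\mathbb C,\ \|X\|_V\le 1\}\in[0,+\infty].$$ A normal state $\rho$ of $\mathcal B(H)$ (a positive normal functional with $\rho(\mathbf 1)=1$) is called $V$-correlated if for every $\epsilon>0$ there are $n\ge 1$, vectors $\xi_1,\dots,\xi_n\in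 V$ and positive reals $t_1,\dots,t_n$ with $t_1+\cdots+t_n=1$ such that $$\sup_{\|A\|\le 1}\Big|\rho(A)-\sum_{k=1}^n t_k\langle A\xi_k,\xi_k\rangle\Big|\le\epsilon.$$ **Theorem.** A normal state $\rho$ of $\mathcal B(H)$ is $V$-correlated if and only if $E(\rho)=1$. -/

import Mathlib

open scoped ComplexOrder

namespace Entanglement

variable {H : Type*} [NormedAddCommGroup H] [InnerProductSpace ℂ H]

/-- The functional `A ↦ ⟨A ξ, η⟩` on `B(H)`, the inner product being linear in its first entry
(Mathlib's is linear in the second one, hence the exchange of the entries). -/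
noncomputable def vectorFunctional (ξ η : H) : (H →L[ℂ] H) →L[ℂ] ℂ :=
  (innerSL ℂ η) ∘L (ContinuousLinearMap.apply ℂ H ξ)

theorem vectorFunctional_apply (ξ η : H) (A : H →L[ℂ] H) :
    vectorFunctional ξ η A = inner ℂ η (A ξ) := rfl

/-- Membership in the predual `B(H)_*`: a functional on `B(H)` is normal if it is of the form
`A ↦ ∑ₙ ⟨A ξₙ, ηₙ⟩` with `∑ₙ ‖ξₙ‖² < ∞` and `∑ₙ ‖ηₙ‖² < ∞` (ultraweak continuity; equivalently
`A ↦ tr (T A)` with `T` of trace class). -/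
def IsNormal (φ : (H →L[ℂ] H) →L[ℂ] ℂ) : Prop :=
  ∃ ξ η : ℕ → H, Summable (fun n => ‖ξ n‖ ^ 2) ∧ Summable (fun n => ‖η n‖ ^ 2) ∧
    ∀ A : H →L[ℂ] H, HasSum (fun n => vectorFunctional (ξ n) (η n) A) (φ A)

/-- A normal state of `B(H)`: a normal functional that is positive and takes `1` to `1`. -/
structure IsNormalState (ρ : (H →L[ℂ] H) →L[ℂ] ℂ) : Prop where
  normal : IsNormal ρ
  nonneg : ∀ A : H →L[ℂ] H, A.IsPositive → 0 ≤ ρ A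
  map_one : ρ 1 = 1

/-- `ρ` is `V`-correlated: a norm limit of convex combinations of vector states from `V`. -/
def IsCorrelated (V : Set H) (ρ : (H →L[ℂ] H) →L[ℂ] ℂ) : Prop :=
  ∀ ε : ℝ, 0 < ε → ∃ (n : ℕ) (ξ : Fin n → H) (t : Fin n → ℝ),
    (∀ k, ξ k ∈ V) ∧ (∀ k, 0 < t k) ∧ ∑ k, t k = 1 ∧
      ‖ρ - ∑ k, (t k : ℂ) • vectorFunctional (ξ k) (ξ k)‖ ≤ ε

/-- `‖X‖_V = sup {|⟨X ξ, η⟩| : ξ, η ∈ V}`. -/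
noncomputable def opVNorm (V : Set H) (X : H →L[ℂ] H) : ENNReal :=
  ⨆ ξ ∈ V, ⨆ η ∈ V, ‖vectorFunctional ξ η X‖ₑ

/-- The algebra `K + ℂ1` of test operators, `K` being the compact operators on `H`. -/
def testOperators (H : Type*) [NormedAddCommGroup H] [InnerProductSpace ℂ H] :
    Set (H →L[ℂ] H) :=
  {X | ∃ (K : H →L[ℂ] H) (c : ℂ), IsCompactOperator K ∧ X = K + c • 1}

/-- The entanglement function
`E(ρ) = sup {|ρ(X)| : X ∈ K + ℂ1, ‖X‖_V ≤ 1}`, with values in `[0, ∞]`. -/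
noncomputable def entanglement (V : Set H) (ρ : (H →L[ℂ] H) →L[ℂ] ℂ) : ENNReal :=
  ⨆ X ∈ {X ∈ testOperators H | opVNorm V X ≤ 1}, ‖ρ X‖ₑ

end Entanglement

namespace Entanglement

open InnerProductSpace

variable {H : Type*} [NormedAddCommGroup H] [InnerProductSpace ℂ H]

/-! Correlated implies `E(ρ) = 1` by averaging: the bound passes to mixtures and norm limits, and
`1` attains it. For the converse, Hahn–Banach and phase invariance of `V` put `ρ`, on any finite set
of test operators, in the closed convex hull of the functionals `⟨· ξ, η⟩`
(`exists_vectorMixture_approx`). Testing against `1` forces the average of `Re ⟨ξ, η⟩` near 1, so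
the unit vectors `ξ`, `η` are close in mean square and `η` may be replaced by `ξ`
(`norm_vectorMixture_sub_le`). This weak approximation becomes a norm approximation because `ρ` is
normal: it nearly lives on a finite-dimensional `W`. Matching `ρ` on matrix units of `W` controls
the compression to `W` and gives the mixture almost full mass there, so nothing escapes
(`norm_vectorMixture_sub_compression_le`). -/

/-- The convex combination `A ↦ ∑ₖ tₖ ⟨A ξₖ, ηₖ⟩` of vector functionals. -/
noncomputable def vectorMixture {κ : Type*} [Fintype κ] (t : κ → ℝ) (ξ η : κ → H) :
    (H →L[ℂ] H) →L[ℂ] ℂ :=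
  ∑ k, (t k : ℂ) • vectorFunctional (ξ k) (η k)

theorem vectorMixture_apply {κ : Type*} [Fintype κ] (t : κ → ℝ) (ξ η : κ → H) (A : H →L[ℂ] H) :
    vectorMixture t ξ η A = ∑ k, (t k : ℂ) * inner ℂ (η k) (A (ξ k)) := by
  simp [vectorMixture, vectorFunctional_apply]

theorem norm_vectorFunctional_apply_le (ξ η : H) (A : H →L[ℂ] H) :
    ‖vectorFunctional ξ η A‖ ≤ ‖A‖ * (‖ξ‖ * ‖η‖) := by
  rw [vectorFunctional_apply]
  calc ‖inner ℂ η (A ξ)‖ ≤ ‖η‖ * ‖A ξ‖ := norm_inner_le_norm _ _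
    _ ≤ ‖η‖ * (‖A‖ * ‖ξ‖) := by gcongr; exact A.le_opNorm ξ
    _ = ‖A‖ * (‖ξ‖ * ‖η‖) := by ring

/-- Jensen's inequality for the square, with an explicit bound. -/
theorem sum_mul_le_of_sum_mul_sq_le {κ : Type*} [Fintype κ] {t a : κ → ℝ} {d : ℝ} (hd : 0 < d)
    (ht : ∀ k, 0 ≤ t k) (ht1 : ∑ k, t k = 1) (ha : ∑ k, t k * a k ^ 2 ≤ d ^ 2) :
    ∑ k, t k * a k ≤ d := by
  have h : ∀ k, t k * a k ≤ t k * (d / 2) + t k * a k ^ 2 / (2 * d) := by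
    intro k
    -- AM-GM, balanced at `a k = d`.
    have h2 : a k ≤ d / 2 + a k ^ 2 / (2 * d) := by
      have : d / 2 + a k ^ 2 / (2 * d) - a k = (d - a k) ^ 2 / (2 * d) := by
        field_simp; ring
      have : 0 ≤ (d - a k) ^ 2 / (2 * d) := by positivity
      linarith
    calc t k * a k ≤ t k * (d / 2 + a k ^ 2 / (2 * d)) := mul_le_mul_of_nonneg_left h2 (ht k)
      _ = _ := by ring
  calc ∑ k, t k * a k ≤ ∑ k, (t k * (d / 2) + t k * a k ^ 2 / (2 * d)) :=
        Finset.sum_le_sum fun k _ => h k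
    _ = d / 2 + (∑ k, t k * a k ^ 2) / (2 * d) := by
        rw [Finset.sum_add_distrib, ← Finset.sum_mul, ht1, Finset.sum_div, one_mul]
    _ ≤ d / 2 + d ^ 2 / (2 * d) := by gcongr
    _ = d := by field_simp; ring

theorem sum_mem_testOperators {ι : Type*} [Fintype ι] (a : ι → ℂ) (X : ι → H →L[ℂ] H)
    (hX : ∀ i, X i ∈ testOperators H) : ∑ i, a i • X i ∈ testOperators H := by
  choose K c hK hc using hX
  refine ⟨∑ i, a i • K i, ∑ i, a i * c i, ?_, ?_⟩
  · exact Submodule.sum_mem (compactOperator (RingHom.id ℂ) H H)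
      (f := fun i => a i • K i) fun i _ => (hK i).smul (a i)
  · simp only [hc, smul_add, smul_smul, Finset.sum_add_distrib, Finset.sum_smul]

theorem one_mem_testOperators : (1 : H →L[ℂ] H) ∈ testOperators H :=
  ⟨0, 1, isCompactOperator_zero, by simp⟩

theorem isCompactOperator_rankOne (x y : H) : IsCompactOperator (rankOne ℂ x y : H →L[ℂ] H) :=
  (isCompactOperator_of_locallyCompactSpace_dom (innerSL ℂ y)).clm_comp
    (ContinuousLinearMap.toSpanSingleton ℂ x)

theorem rankOne_mem_testOperators (x y : H) : rankOne ℂ x y ∈ testOperators H :=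
  ⟨_, 0, isCompactOperator_rankOne x y, by simp⟩

/-- Homogeneity: rescaling by `u⁻¹` brings `X` into the unit ball of the `V`-norm. -/
theorem norm_apply_le_of_entanglement_le_one {V : Set H} {ρ : (H →L[ℂ] H) →L[ℂ] ℂ}
    (hE : entanglement V ρ ≤ 1) {X : H →L[ℂ] H} (hX : X ∈ testOperators H) {u : ℝ} (hu : 0 < u)
    (h : ∀ ξ ∈ V, ∀ η ∈ V, ‖vectorFunctional ξ η X‖ ≤ u) : ‖ρ X‖ ≤ u := by
  have hm : ((u⁻¹ : ℝ) : ℂ) • X ∈ {X ∈ testOperators H | opVNorm V X ≤ 1} := by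
    constructor
    · simpa using sum_mem_testOperators (fun _ : Unit => ((u⁻¹ : ℝ) : ℂ)) (fun _ => X)
        (fun _ => hX)
    · refine iSup₂_le fun ξ hξ => iSup₂_le fun η hη => ?_
      have h1 : ‖vectorFunctional ξ η (((u⁻¹ : ℝ) : ℂ) • X)‖ ≤ 1 := by
        rw [map_smul, norm_smul, Complex.norm_real, Real.norm_of_nonneg (by positivity),
          inv_mul_le_iff₀ hu, mul_one]
        exact h ξ hξ η hη
      rw [← ofReal_norm]
      exact ENNReal.ofReal_le_one.2 h1
  have h2 : ‖ρ (((u⁻¹ : ℝ) : ℂ) • X)‖ₑ ≤ 1 :=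
    (le_iSup₂ (f := fun X _ => ‖ρ X‖ₑ) (((u⁻¹ : ℝ) : ℂ) • X) hm).trans hE
  rw [← ofReal_norm, ENNReal.ofReal_le_one, map_smul, norm_smul, Complex.norm_real,
    Real.norm_of_nonneg (by positivity), inv_mul_le_iff₀ hu, mul_one] at h2
  exact h2

/-! ### Separation and reduction to vector states -/

/-- If `E(ρ) ≤ 1` then, on any finite family of test operators, `ρ` is approximated by convex
combinations of the functionals `A ↦ ⟨A ξ, η⟩` with `ξ, η ∈ V`. -/
theorem exists_vectorMixture_approx {V : Set H} (hne : V.Nonempty)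
    (hV1 : ∀ c : ℂ, ‖c‖ = 1 → ∀ ξ ∈ V, c • ξ ∈ V)
    {ρ : (H →L[ℂ] H) →L[ℂ] ℂ} (hE : entanglement V ρ ≤ 1)
    {ι : Type*} [Fintype ι] (X : ι → H →L[ℂ] H) (hX : ∀ i, X i ∈ testOperators H)
    {ε : ℝ} (hε : 0 < ε) :
    ∃ (n : ℕ) (ξ η : Fin n → H) (t : Fin n → ℝ), (∀ k, ξ k ∈ V) ∧ (∀ k, η k ∈ V) ∧
      (∀ k, 0 < t k) ∧ ∑ k, t k = 1 ∧ ∀ i, ‖ρ (X i) - vectorMixture t ξ η (X i)‖ ≤ ε := by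
  classical
  set S : Set (ι → ℂ) := {z | ∃ ξ ∈ V, ∃ η ∈ V, z = fun i => vectorFunctional ξ η (X i)} with hS
  have key : (fun i => ρ (X i)) ∈ closure (convexHull ℝ S) := by
    by_contra hcon
    obtain ⟨f, u, hfu, hux⟩ := RCLike.geometric_hahn_banach_closed_point (𝕜 := ℂ)
      (convex_convexHull ℝ S).closure isClosed_closure hcon
    set a : ι → ℂ := fun i => f (Pi.single i 1) with ha
    have hf : ∀ z : ι → ℂ, f z = ∑ i, a i * z i := by
      intro z
      have h := LinearMap.pi_apply_eq_sum_univ (f : (ι → ℂ) →ₗ[ℂ] ℂ) z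
      simp only [ContinuousLinearMap.coe_coe, smul_eq_mul] at h
      rw [h]
      refine Finset.sum_congr rfl fun i _ => ?_
      rw [mul_comm, ha]
      congr 2
      ext j
      simp [Pi.single_apply, eq_comm]
    -- The separating functional is evaluation at the single test operator `Y`.
    set Y : H →L[ℂ] H := ∑ i, a i • X i with hY
    have hfφ : ∀ φ : (H →L[ℂ] H) →L[ℂ] ℂ, f (fun i => φ (X i)) = φ Y := by
      intro φ
      simp [hf, hY]
    have hre : ∀ ξ ∈ V, ∀ η ∈ V, (vectorFunctional ξ η Y).re < u := by
      intro ξ hξ η hη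
      have := hfu _ (subset_closure (subset_convexHull ℝ S ⟨ξ, hξ, η, hη, rfl⟩))
      rwa [hfφ] at this
    have hnorm : ∀ ξ ∈ V, ∀ η ∈ V, ‖vectorFunctional ξ η Y‖ < u := by
      intro ξ hξ η hη
      obtain ⟨c, hc, hcz⟩ := RCLike.exists_norm_mul_eq_self (vectorFunctional ξ η Y)
      have hc' : ‖c⁻¹‖ = 1 := by simp [hc]
      have hc0 : c ≠ 0 := by rintro rfl; simp at hc
      -- Rotating `ξ` by a phase turns the bound on real parts into one on moduli.
      have := hre (c⁻¹ • ξ) (hV1 _ hc' ξ hξ) η hη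
      have e : vectorFunctional (c⁻¹ • ξ) η Y = (‖vectorFunctional ξ η Y‖ : ℂ) := by
        have : vectorFunctional (c⁻¹ • ξ) η Y = c⁻¹ * vectorFunctional ξ η Y := by
          simp [vectorFunctional_apply]
        rw [this, ← hcz]
        simp [hc0, hc]
      rwa [e, Complex.ofReal_re] at this
    obtain ⟨ξ₀, h₀⟩ := hne
    have hu : 0 < u := (norm_nonneg _).trans_lt (hnorm ξ₀ h₀ ξ₀ h₀)
    have h1 := norm_apply_le_of_entanglement_le_one hE (sum_mem_testOperators a X hX) hu
      (fun ξ hξ η hη => (hnorm ξ hξ η hη).le)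
    have h2 : u < (ρ Y).re := by
      rw [hfφ] at hux
      exact hux
    exact absurd (h2.trans_le ((Complex.re_le_norm _).trans h1)) (lt_irrefl _)
  obtain ⟨z, hz, hd⟩ := Metric.mem_closure_iff.1 key ε hε
  obtain ⟨κ, _, w, t, hw, -, ht, ht1, hsum⟩ := eq_pos_convex_span_of_mem_convexHull hz
  choose ξ hξ η hη hwe using fun k => hw (Set.mem_range_self k)
  let e := (Fintype.equivFin κ).symm
  refine ⟨_, ξ ∘ e, η ∘ e, t ∘ e, fun k => hξ _, fun k => hη _, fun k => ht _, ?_, fun i => ?_⟩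
  · rw [← ht1]
    exact e.sum_comp t
  · have h1 : vectorMixture (t ∘ e) (ξ ∘ e) (η ∘ e) (X i) = z i := by
      rw [vectorMixture_apply, ← hsum, Finset.sum_apply]
      simp only [Function.comp_apply]
      rw [e.sum_comp (fun k => (t k : ℂ) * inner ℂ (η k) (X i (ξ k)))]
      refine Finset.sum_congr rfl fun k _ => ?_
      rw [Pi.smul_apply, hwe k, ← vectorFunctional_apply, Complex.real_smul]
    rw [h1]
    have := (dist_le_pi_dist (fun i => ρ (X i)) z i).trans hd.le
    rwa [dist_eq_norm] at this

/-- A convex combination of the functionals `A ↦ ⟨A ξ, η⟩` that almost takes `1` to `1` is close to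
the corresponding convex combination of vector states. -/
theorem norm_vectorMixture_sub_le {κ : Type*} [Fintype κ] {t : κ → ℝ} {ξ η : κ → H} {d : ℝ}
    (hd : 0 < d) (ht : ∀ k, 0 ≤ t k) (ht1 : ∑ k, t k = 1) (hξ : ∀ k, ‖ξ k‖ = 1)
    (hη : ∀ k, ‖η k‖ = 1) (h : ‖1 - vectorMixture t ξ η 1‖ ≤ d ^ 2 / 2) (A : H →L[ℂ] H) :
    ‖vectorMixture t ξ η A - vectorMixture t ξ ξ A‖ ≤ d * ‖A‖ := by
  have hsq : ∑ k, t k * ‖η k - ξ k‖ ^ 2 ≤ d ^ 2 := by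
    have h1 : ∑ k, t k * ‖η k - ξ k‖ ^ 2 = 2 * (1 - vectorMixture t ξ η 1).re := by
      have h2 : ∀ k, t k * ‖η k - ξ k‖ ^ 2
          = 2 * t k - 2 * ((t k : ℂ) * inner ℂ (η k) ((1 : H →L[ℂ] H) (ξ k))).re := by
        intro k
        rw [@norm_sub_sq ℂ, hξ, hη, Complex.re_ofReal_mul]
        simp only [one_apply_eq_self, RCLike.re_to_complex]
        ring
      rw [Finset.sum_congr rfl fun k _ => h2 k, Finset.sum_sub_distrib, ← Finset.mul_sum, ht1,
        ← Finset.mul_sum, vectorMixture_apply, Complex.sub_re, Complex.re_sum, Complex.one_re]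
      ring
    rw [h1]
    have := (Complex.re_le_norm _).trans h
    linarith
  have hlin := sum_mul_le_of_sum_mul_sq_le hd ht ht1 hsq
  rw [vectorMixture_apply, vectorMixture_apply, ← Finset.sum_sub_distrib]
  calc ‖∑ k, ((t k : ℂ) * inner ℂ (η k) (A (ξ k)) - (t k : ℂ) * inner ℂ (ξ k) (A (ξ k)))‖
      ≤ ∑ k, t k * ‖η k - ξ k‖ * ‖A‖ := by
        refine (norm_sum_le _ _).trans (Finset.sum_le_sum fun k _ => ?_)
        rw [← mul_sub, ← inner_sub_left, norm_mul, Complex.norm_real, Real.norm_of_nonneg (ht k),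
          mul_assoc]
        refine mul_le_mul_of_nonneg_left ?_ (ht k)
        have := norm_vectorFunctional_apply_le (ξ k) (η k - ξ k) A
        rw [vectorFunctional_apply, hξ, one_mul] at this
        linarith
    _ = (∑ k, t k * ‖η k - ξ k‖) * ‖A‖ := by rw [Finset.sum_mul]
    _ ≤ d * ‖A‖ := by gcongr

/-- If `E(ρ) ≤ 1` and `ρ(1) = 1` then, on any finite family of test operators, `ρ` is approximated
by convex combinations of vector states from `V`. -/
theorem exists_stateMixture_approx {V : Set H} (hne : V.Nonempty) (hunit : ∀ ξ ∈ V, ‖ξ‖ = 1)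
    (hV1 : ∀ c : ℂ, ‖c‖ = 1 → ∀ ξ ∈ V, c • ξ ∈ V)
    {ρ : (H →L[ℂ] H) →L[ℂ] ℂ} (hE : entanglement V ρ ≤ 1) (hρ1 : ρ 1 = 1)
    {ι : Type*} [Fintype ι] (X : ι → H →L[ℂ] H) (hX : ∀ i, X i ∈ testOperators H)
    {ε : ℝ} (hε : 0 < ε) :
    ∃ (n : ℕ) (ξ : Fin n → H) (t : Fin n → ℝ), (∀ k, ξ k ∈ V) ∧
      (∀ k, 0 < t k) ∧ ∑ k, t k = 1 ∧ ∀ i, ‖ρ (X i) - vectorMixture t ξ ξ (X i)‖ ≤ ε := by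
  set M : ℝ := ∑ i, ‖X i‖ with hM
  have hM0 : 0 ≤ M := Finset.sum_nonneg fun i _ => norm_nonneg _
  have hXM : ∀ i, ‖X i‖ ≤ M := fun i =>
    Finset.single_le_sum (f := fun i => ‖X i‖) (fun i _ => norm_nonneg _) (Finset.mem_univ i)
  set d : ℝ := ε / 2 / (M + 1) with hd
  have hd0 : 0 < d := by positivity
  -- The extra index `none` carries the test operator `1`, which forces `η` close to `ξ`.
  obtain ⟨n, ξ, η, t, hξ, hη, ht, ht1, happ⟩ := exists_vectorMixture_approx hne hV1 hE
    (fun o : Option ι => o.elim 1 X)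
    (fun o => by cases o; exacts [one_mem_testOperators, hX _])
    (ε := min (ε / 2) (d ^ 2 / 2)) (by positivity)
  refine ⟨n, ξ, t, hξ, ht, ht1, fun i => ?_⟩
  have h1 : ‖1 - vectorMixture t ξ η 1‖ ≤ d ^ 2 / 2 := by
    have := (happ none).trans (min_le_right _ _)
    simpa [hρ1] using this
  have h2 : ‖ρ (X i) - vectorMixture t ξ η (X i)‖ ≤ ε / 2 := (happ (some i)).trans (min_le_left _ _)
  have h3 := norm_vectorMixture_sub_le hd0 (fun k => (ht k).le) ht1 (fun k => hunit _ (hξ k))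
    (fun k => hunit _ (hη k)) h1 (X i)
  have h4 : d * ‖X i‖ ≤ ε / 2 := by
    calc d * ‖X i‖ ≤ d * (M + 1) := by gcongr; linarith [hXM i]
      _ = ε / 2 := by rw [hd]; field_simp
  calc ‖ρ (X i) - vectorMixture t ξ ξ (X i)‖
      ≤ ‖ρ (X i) - vectorMixture t ξ η (X i)‖
        + ‖vectorMixture t ξ η (X i) - vectorMixture t ξ ξ (X i)‖ :=
        norm_sub_le_norm_sub_add_norm_sub _ _ _
    _ ≤ ε := by linarith

/-! ### Compression to finite-dimensional subspaces -/

/-- Compressing the first and the second vector of `⟨A ξ, η⟩` changes it little. -/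
theorem norm_vectorFunctional_sub_compression_le (W : Submodule ℂ H) [W.HasOrthogonalProjection]
    (ξ η : H) (A : H →L[ℂ] H) :
    ‖vectorFunctional ξ η A - vectorFunctional ξ η (W.starProjection ∘L A ∘L W.starProjection)‖
      ≤ ‖A‖ * (‖ξ - W.starProjection ξ‖ * ‖η‖ + ‖ξ‖ * ‖η - W.starProjection η‖) := by
  have e : vectorFunctional ξ η A - vectorFunctional ξ η (W.starProjection ∘L A ∘L W.starProjection)
      = vectorFunctional (ξ - W.starProjection ξ) η A
        + vectorFunctional (W.starProjection ξ) (η - W.starProjection η) A := by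
    simp only [vectorFunctional_apply, ContinuousLinearMap.comp_apply, map_sub, inner_sub_right,
      inner_sub_left, ← Submodule.inner_starProjection_left_eq_right]
    ring
  rw [e]
  have h1 := norm_vectorFunctional_apply_le (ξ - W.starProjection ξ) η A
  have h2 := norm_vectorFunctional_apply_le (W.starProjection ξ) (η - W.starProjection η) A
  have h3 : ‖W.starProjection ξ‖ ≤ ‖ξ‖ := W.norm_starProjection_apply_le ξ
  calc _ ≤ ‖A‖ * (‖ξ - W.starProjection ξ‖ * ‖η‖)
        + ‖A‖ * (‖W.starProjection ξ‖ * ‖η - W.starProjection η‖) :=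
        (norm_add_le _ _).trans (add_le_add h1 h2)
    _ ≤ ‖A‖ * (‖ξ - W.starProjection ξ‖ * ‖η‖) + ‖A‖ * (‖ξ‖ * ‖η - W.starProjection η‖) := by
        gcongr
    _ = _ := by ring

theorem norm_sub_starProjection_le (W : Submodule ℂ H) [W.HasOrthogonalProjection] (x : H) :
    ‖x - W.starProjection x‖ ≤ ‖x‖ := by
  rw [← Submodule.starProjection_orthogonal_val]
  exact Wᗮ.norm_starProjection_apply_le x

/-- A normal functional is concentrated, up to a small error, on a finite-dimensional subspace. -/
theorem IsNormal.exists_finiteDimensional {ρ : (H →L[ℂ] H) →L[ℂ] ℂ} (hρ : IsNormal ρ)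
    {ε : ℝ} (hε : 0 < ε) :
    ∃ (W : Submodule ℂ H) (_ : FiniteDimensional ℂ W), ∀ A : H →L[ℂ] H,
      ‖ρ A - ρ (W.starProjection ∘L A ∘L W.starProjection)‖ ≤ ε * ‖A‖ := by
  obtain ⟨ξ, η, hξ, hη, hsum⟩ := hρ
  set g : ℕ → ℝ := fun n => 2 * (‖ξ n‖ * ‖η n‖) with hg
  have hgs : Summable g := by
    refine Summable.of_nonneg_of_le (fun n => by positivity) (fun n => ?_) (hξ.add hη)
    have := sq_nonneg (‖ξ n‖ - ‖η n‖)
    simp only [hg]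
    nlinarith
  have htail := tendsto_sum_nat_add g
  obtain ⟨N, hN⟩ := (htail.eventually (gt_mem_nhds hε)).exists
  -- Compression to `W` leaves the first `N` terms of the series unchanged; only the tail
  -- contributes.
  set W : Submodule ℂ H := Submodule.span ℂ (ξ '' Set.Iio N ∪ η '' Set.Iio N) with hW
  have hfin : FiniteDimensional ℂ W := FiniteDimensional.span_of_finite ℂ
    (((Set.finite_Iio N).image ξ).union ((Set.finite_Iio N).image η))
  refine ⟨W, hfin, fun A => ?_⟩
  have hPξ : ∀ n < N, W.starProjection (ξ n) = ξ n := fun n hn =>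
    Submodule.starProjection_eq_self_iff.2 (Submodule.subset_span (Or.inl ⟨n, hn, rfl⟩))
  have hPη : ∀ n < N, W.starProjection (η n) = η n := fun n hn =>
    Submodule.starProjection_eq_self_iff.2 (Submodule.subset_span (Or.inr ⟨n, hn, rfl⟩))
  set F : ℕ → ℂ := fun n => vectorFunctional (ξ n) (η n) A
    - vectorFunctional (ξ n) (η n) (W.starProjection ∘L A ∘L W.starProjection) with hF
  have hFs : HasSum F (ρ A - ρ (W.starProjection ∘L A ∘L W.starProjection)) :=
    (hsum A).sub (hsum _)
  have hF0 : ∀ n < N, F n = 0 := by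
    intro n hn
    have := norm_vectorFunctional_sub_compression_le W (ξ n) (η n) A
    rw [hPξ n hn, hPη n hn] at this
    simpa using this
  have hFb : ∀ n, ‖F n‖ ≤ ‖A‖ * g n := by
    intro n
    refine (norm_vectorFunctional_sub_compression_le W (ξ n) (η n) A).trans ?_
    have h1 := norm_sub_starProjection_le W (ξ n)
    have h2 := norm_sub_starProjection_le W (η n)
    calc _ ≤ ‖A‖ * (‖ξ n‖ * ‖η n‖ + ‖ξ n‖ * ‖η n‖) := by gcongr
      _ = ‖A‖ * g n := by simp only [hg]; ring
  have hshift : HasSum (fun n => F (n + N))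
      (ρ A - ρ (W.starProjection ∘L A ∘L W.starProjection)) := by
    rw [hasSum_nat_add_iff, Finset.sum_eq_zero fun n hn => hF0 n (Finset.mem_range.1 hn), add_zero]
    exact hFs
  have hgshift : Summable fun n => ‖A‖ * g (n + N) :=
    ((summable_nat_add_iff N).2 hgs).mul_left _
  rw [← hshift.tsum_eq]
  calc _ ≤ ∑' n, ‖A‖ * g (n + N) := tsum_of_norm_bounded hgshift.hasSum fun n => hFb _
    _ = ‖A‖ * ∑' n, g (n + N) := tsum_mul_left
    _ ≤ ‖A‖ * ε := by gcongr
    _ = ε * ‖A‖ := mul_comm _ _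

/-- A functional on the compressions to a finite-dimensional subspace is controlled by its values
on finitely many operators of rank one. -/
theorem norm_apply_compression_le (W : Submodule ℂ H) [FiniteDimensional ℂ W]
    {ι : Type*} [Fintype ι] (b : OrthonormalBasis ι ℂ W) (θ : (H →L[ℂ] H) →L[ℂ] ℂ) {d : ℝ}
    (h : ∀ p : ι × ι, ‖θ (rankOne ℂ (b p.1 : H) (b p.2 : H))‖ ≤ d) (A : H →L[ℂ] H) :
    ‖θ (W.starProjection ∘L A ∘L W.starProjection)‖ ≤ Fintype.card (ι × ι) * d * ‖A‖ := by
  have e : W.starProjection ∘L A ∘L W.starProjection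
      = ∑ p : ι × ι, (inner ℂ (b p.1 : H) (A (b p.2))) • rankOne ℂ (b p.1 : H) (b p.2 : H) := by
    ext x
    simp only [ContinuousLinearMap.comp_apply, b.starProjection_eq_sum_rankOne,
      sum_apply, map_sum, rankOne_apply, map_smul, Fintype.sum_prod_type,
      smul_apply, Finset.smul_sum]
    rw [Finset.sum_comm]
    refine Finset.sum_congr rfl fun i _ => Finset.sum_congr rfl fun j _ => ?_
    rw [smul_smul, smul_smul, mul_comm]
  have hb : ∀ i, ‖(b i : H)‖ = 1 := fun i => b.norm_eq_one i
  rw [e, map_sum]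
  calc _ ≤ ∑ _p : ι × ι, ‖A‖ * d := by
        refine norm_sum_le_of_le _ fun p _ => ?_
        rw [map_smul, norm_smul]
        refine mul_le_mul ?_ (h p) (norm_nonneg _) (norm_nonneg _)
        have := norm_vectorFunctional_apply_le (b p.2 : H) (b p.1 : H) A
        rwa [vectorFunctional_apply, hb, hb, mul_one, mul_one] at this
    _ = _ := by
        rw [Finset.sum_const, Finset.card_univ, nsmul_eq_mul]; ring

/-- A mixture of vector states with most of its mass on `W` is close to its compression to `W`. -/
theorem norm_vectorMixture_sub_compression_le (W : Submodule ℂ H) [W.HasOrthogonalProjection]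
    {κ : Type*} [Fintype κ] {t : κ → ℝ} {ξ : κ → H} {d : ℝ} (hd : 0 < d) (ht : ∀ k, 0 ≤ t k)
    (ht1 : ∑ k, t k = 1) (hξ : ∀ k, ‖ξ k‖ = 1)
    (h : ‖1 - vectorMixture t ξ ξ W.starProjection‖ ≤ d ^ 2) (A : H →L[ℂ] H) :
    ‖vectorMixture t ξ ξ A - vectorMixture t ξ ξ (W.starProjection ∘L A ∘L W.starProjection)‖
      ≤ 2 * d * ‖A‖ := by
  have hsq : ∑ k, t k * ‖ξ k - W.starProjection (ξ k)‖ ^ 2 ≤ d ^ 2 := by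
    -- Pythagoras: the squared distance from a unit vector to `W` is its missing mass.
    have h1 : ∀ k, t k * ‖ξ k - W.starProjection (ξ k)‖ ^ 2
        = t k - ((t k : ℂ) * inner ℂ (ξ k) (W.starProjection (ξ k))).re := by
      intro k
      have h2 := W.norm_sq_eq_add_norm_sq_starProjection (ξ k)
      rw [Submodule.starProjection_orthogonal_val, hξ] at h2
      have h3 : (inner ℂ (ξ k) (W.starProjection (ξ k))).re = ‖W.starProjection (ξ k)‖ ^ 2 := by
        have : W.starProjection (W.starProjection (ξ k)) = W.starProjection (ξ k) :=
          Submodule.starProjection_eq_self_iff.2 (W.starProjection_apply_mem _)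
        rw [← this, ← Submodule.inner_starProjection_left_eq_right, this]
        exact inner_self_eq_norm_sq (𝕜 := ℂ) _
      rw [Complex.re_ofReal_mul, h3]
      linear_combination t k * (-h2)
    rw [Finset.sum_congr rfl fun k _ => h1 k, Finset.sum_sub_distrib, ht1, ← Complex.re_sum,
      ← vectorMixture_apply, ← Complex.one_re, ← Complex.sub_re]
    exact (Complex.re_le_norm _).trans h
  have hlin := sum_mul_le_of_sum_mul_sq_le hd ht ht1 hsq
  simp only [vectorMixture_apply, ← Finset.sum_sub_distrib, ← mul_sub]
  calc _ ≤ ∑ k, t k * ‖ξ k - W.starProjection (ξ k)‖ * (2 * ‖A‖) := by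
        refine norm_sum_le_of_le _ fun k _ => ?_
        rw [norm_mul, Complex.norm_real, Real.norm_of_nonneg (ht k), mul_assoc]
        refine mul_le_mul_of_nonneg_left ?_ (ht k)
        have := norm_vectorFunctional_sub_compression_le W (ξ k) (ξ k) A
        rw [vectorFunctional_apply, vectorFunctional_apply, hξ] at this
        linarith
    _ = (∑ k, t k * ‖ξ k - W.starProjection (ξ k)‖) * (2 * ‖A‖) := by rw [Finset.sum_mul]
    _ ≤ d * (2 * ‖A‖) := by gcongr
    _ = _ := by ring

/-! ### The two implications -/

theorem isCorrelated_of_entanglement_le_one {V : Set H} (hne : V.Nonempty)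
    (hunit : ∀ ξ ∈ V, ‖ξ‖ = 1) (hV1 : ∀ c : ℂ, ‖c‖ = 1 → ∀ ξ ∈ V, c • ξ ∈ V)
    {ρ : (H →L[ℂ] H) →L[ℂ] ℂ} (hρ : IsNormal ρ) (hρ1 : ρ 1 = 1)
    (hE : entanglement V ρ ≤ 1) : IsCorrelated V ρ := by
  intro ε hε
  -- Error budget: `d` for compressing `ρ`, `d` for comparing compressions, `2 * d` for compressing
  -- the mixture.
  set d : ℝ := ε / 4 with hd
  have hd0 : 0 < d := by positivity
  -- Two errors `δ` add up to the mass defect, which must be at most `d ^ 2`.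
  set δ : ℝ := min d (d ^ 2 / 2) with hδ
  have hδ0 : 0 < δ := by positivity
  have hδ1 : δ ≤ d := min_le_left _ _
  have hδ2 : δ ≤ d ^ 2 / 2 := min_le_right _ _
  obtain ⟨W, hfin, hW⟩ := hρ.exists_finiteDimensional hδ0
  let b := stdOrthonormalBasis ℂ W
  let ι := Fin (Module.finrank ℂ W)
  have hm : 0 < (Fintype.card (ι × ι) : ℝ) + 1 := by positivity
  obtain ⟨n, ξ, t, hξ, ht, ht1, happ⟩ := exists_stateMixture_approx hne hunit hV1 hE hρ1
    (fun p : ι × ι => rankOne ℂ (b p.1 : H) (b p.2 : H))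
    (fun p => rankOne_mem_testOperators _ _) (ε := δ / (Fintype.card (ι × ι) + 1)) (by positivity)
  refine ⟨n, ξ, t, hξ, ht, ht1, ?_⟩
  change ‖ρ - vectorMixture t ξ ξ‖ ≤ ε
  set φ := vectorMixture t ξ ξ with hφ
  have hcomp : ∀ A : H →L[ℂ] H, ‖ρ (W.starProjection ∘L A ∘L W.starProjection)
      - φ (W.starProjection ∘L A ∘L W.starProjection)‖ ≤ δ * ‖A‖ := by
    intro A
    have := norm_apply_compression_le W b (ρ - φ) happ A
    rw [sub_apply] at this
    refine this.trans (mul_le_mul_of_nonneg_right ?_ (norm_nonneg _))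
    rw [mul_div_assoc', div_le_iff₀ hm]
    nlinarith
  have hone : ‖(1 : H →L[ℂ] H)‖ ≤ 1 := ContinuousLinearMap.norm_id_le
  have hP : W.starProjection ∘L (1 : H →L[ℂ] H) ∘L W.starProjection = W.starProjection :=
    W.isIdempotentElem_starProjection
  have h1 : ‖1 - φ W.starProjection‖ ≤ d ^ 2 := by
    have ha := hW 1
    have hb := hcomp 1
    rw [hP, hρ1] at ha
    rw [hP] at hb
    have := norm_sub_le_norm_sub_add_norm_sub 1 (ρ W.starProjection) (φ W.starProjection)
    nlinarith
  refine ContinuousLinearMap.opNorm_le_bound _ hε.le fun A => ?_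
  have h2 := norm_vectorMixture_sub_compression_le W hd0 (fun k => (ht k).le) ht1
    (fun k => hunit _ (hξ k)) h1 A
  have h3 := hW A
  have h4 := hcomp A
  rw [norm_sub_rev, ← hφ] at h2
  rw [sub_apply]
  set B := W.starProjection ∘L A ∘L W.starProjection
  have h5 := norm_sub_le_norm_sub_add_norm_sub (ρ A) (ρ B) (φ A)
  have h6 := norm_sub_le_norm_sub_add_norm_sub (ρ B) (φ B) (φ A)
  have h7 : δ * ‖A‖ ≤ d * ‖A‖ := by gcongr
  have h8 : ε * ‖A‖ = 4 * d * ‖A‖ := by rw [hd]; ring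
  linarith

/-- Only the diagonal pairs `(ξ, ξ)` of the `V`-norm matter, and `X` may be any bounded operator. -/
theorem IsCorrelated.norm_apply_le {V : Set H} {ρ : (H →L[ℂ] H) →L[ℂ] ℂ} (h : IsCorrelated V ρ)
    {X : H →L[ℂ] H} (hX : opVNorm V X ≤ 1) : ‖ρ X‖ ≤ 1 := by
  have hb : ∀ ξ ∈ V, ‖vectorFunctional ξ ξ X‖ ≤ 1 := by
    intro ξ hξ
    have h1 : ‖vectorFunctional ξ ξ X‖ₑ ≤ opVNorm V X :=
      (le_iSup₂ (f := fun η _ => ‖vectorFunctional ξ η X‖ₑ) ξ hξ).trans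
        (le_iSup₂ (f := fun ξ _ => ⨆ η ∈ V, ‖vectorFunctional ξ η X‖ₑ) ξ hξ)
    have h2 := h1.trans hX
    rwa [← ofReal_norm, ENNReal.ofReal_le_one] at h2
  refine le_of_forall_pos_le_add fun ε hε => ?_
  obtain ⟨n, ξ, t, hξ, ht, ht1, hn⟩ := h (ε / (‖X‖ + 1)) (by positivity)
  set φ := ∑ k, (t k : ℂ) • vectorFunctional (ξ k) (ξ k) with hφ
  have h1 : ‖φ X‖ ≤ 1 := by
    rw [hφ, sum_apply, ← ht1]
    refine norm_sum_le_of_le _ fun k _ => ?_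
    rw [smul_apply, norm_smul, Complex.norm_real,
      Real.norm_of_nonneg (ht k).le]
    exact mul_le_of_le_one_right (ht k).le (hb _ (hξ k))
  have h2 : ‖ρ X - φ X‖ ≤ ε := by
    have := (ρ - φ).le_of_opNorm_le hn X
    refine this.trans ?_
    rw [div_mul_eq_mul_div, div_le_iff₀ (by positivity)]
    nlinarith
  have h3 := norm_le_norm_add_norm_sub' (ρ X) (φ X)
  linarith

theorem one_le_entanglement {V : Set H} (hunit : ∀ ξ ∈ V, ‖ξ‖ = 1) {ρ : (H →L[ℂ] H) →L[ℂ] ℂ}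
    (hρ1 : ρ 1 = 1) : 1 ≤ entanglement V ρ := by
  have hm : (1 : H →L[ℂ] H) ∈ {X ∈ testOperators H | opVNorm V X ≤ 1} := by
    refine ⟨one_mem_testOperators, iSup₂_le fun ξ hξ => iSup₂_le fun η hη => ?_⟩
    rw [← ofReal_norm, ENNReal.ofReal_le_one, vectorFunctional_apply]
    simpa [hunit ξ hξ, hunit η hη] using norm_inner_le_norm (𝕜 := ℂ) η ξ
  have := le_iSup₂ (f := fun X _ => ‖ρ X‖ₑ) (1 : H →L[ℂ] H) hm
  rwa [hρ1, enorm_one] at this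

end Entanglement

theorem theorem6p1 {H : Type*} [NormedAddCommGroup H] [InnerProductSpace ℂ H] [CompleteSpace H]
    (V : Set H) (hclosed : IsClosed V) (hunit : ∀ ξ ∈ V, ‖ξ‖ = 1)
    (hV1 : ∀ c : ℂ, ‖c‖ = 1 → ∀ ξ ∈ V, c • ξ ∈ V)
    (hV2 : ∀ ξ : H, (∀ η ∈ V, inner ℂ ξ η = 0) → ξ = 0)
    (ρ : (H →L[ℂ] H) →L[ℂ] ℂ) (hρ : Entanglement.IsNormalState ρ) :
    Entanglement.IsCorrelated V ρ ↔ Entanglement.entanglement V ρ = 1 := by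
  constructor
  · intro h
    refine le_antisymm (iSup₂_le fun X hX => ?_)
      (Entanglement.one_le_entanglement hunit hρ.map_one)
    rw [← ofReal_norm, ENNReal.ofReal_le_one]
    exact h.norm_apply_le hX.2
  · intro h
    refine Entanglement.isCorrelated_of_entanglement_le_one ?_ hunit hV1 hρ.normal hρ.map_one h.le
    -- If `V` were empty, `hV2` would force `H = 0`, hence `1 = 0`, against `ρ 1 = 1`.
    by_contra hV
    have hzero : ∀ x : H, x = 0 := fun x =>
      hV2 x fun η hη => absurd ⟨η, hη⟩ hV
    have h10 : (1 : H →L[ℂ] H) = 0 := by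
      ext x
      rw [hzero x, map_zero, map_zero]
    have := hρ.map_one
    rw [h10, map_zero] at this
    exact zero_ne_one this
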